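/- **Theorem 2.2.** Let $\mathbb{D}$ be the open unit disk in $\mathbb{C}$. For $\lambda\in\mathbb{D}$ and $r>0$ let $D(\lambda,r)=\{z\in\mathbb{D}:\ |\lambda-z|/|1-\overline{\lambda}z|<r\}$ be the pseudohyperbolic disk. For $\alpha>0$ let $\mathcal{A}^\infty_\alpha$ be the space of holomorphic functions $f$ on $\mathbb{D}$ with $\sup_{z\in\mathbb{D}}(1-|z|^2)^{\alpha/2}|f(z)|<\infty$. Let $\alpha>0$ and $\varepsilon>0$, let $\Lambda\subset\mathbb{D}$, and let $m_\lambda\ge 1$ be an integer for each $\lambda\in\Lambda$. Suppose that there is a compact set $K\subset\mathbb{D}$ such that $$\mathbb{D}\setminus K\subseteq\bigcup_{\lambda\in\Lambda}D\left(\lambda,\sqrt{\frac{m_\lambda}{m_\lambda+\alpha+\varepsilon}}\right).$$ Then $\{(\lambda,m_\lambda)\}_{\lambda\in\Lambda}$ is a uniqueness divisor for $\mathcal{A}^\infty_\alpha$: if $f\in\mathcal{A}^\infty_\alpha$ satisfies $f^{(j)}(\lambda)=0$ for all $\lambda\in\Lambda$ and all $0\le j<m_\lambda$, then $f=0$ on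 $\mathbb{D}$. -/

import Mathlib

noncomputable section

namespace BergmanUniqueness

/-- The open unit disk `𝔻` in `ℂ`. -/
def unitDisk : Set ℂ := Metric.ball 0 1

/-- The Möbius transform `φ_λ(z) = (λ - z) / (1 - conj λ * z)`. -/
def mobius (l z : ℂ) : ℂ := (l - z) / (1 - (starRingEnd ℂ) l * z)

/-- The pseudohyperbolic distance `ρ(u, v) = |φ_u(v)|`, for `u, v` in the unit disk. -/
def rho (u v : ℂ) : ℝ := ‖mobius u v‖

/-- The pseudohyperbolic disk `D(λ, r) = {z ∈ 𝔻 : ρ(λ, z) < r}`. -/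
def pseudoDisk (l : ℂ) (r : ℝ) : Set ℂ := {z | z ∈ unitDisk ∧ rho l z < r}

/-- The growth space `A^∞_α`: functions holomorphic on the unit disk such that
`sup_{z ∈ 𝔻} (1 - |z|²)^{α/2} |f z|` is finite. Elements are represented by functions on `ℂ`,
whose values outside the disk play no role. -/
def growthSpace (α : ℝ) : Set (ℂ → ℂ) :=
  {f | DifferentiableOn ℂ f unitDisk ∧
    BddAbove ((fun z : ℂ => (1 - ‖z‖ ^ 2) ^ (α / 2) * ‖f z‖) '' unitDisk)}

/-- A divisor `X = {(λ, m_λ)}_{λ ∈ Λ}`: a set `Λ` of points of the unit disk, each with a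
multiplicity `m_λ ≥ 1`. -/
structure DiskDivisor where
  /-- The set `Λ`. -/
  points : Set ℂ
  /-- The points lie in the unit disk. -/
  points_subset : points ⊆ unitDisk
  /-- The multiplicities `m_λ`; only the values at points of `Λ` matter. -/
  mult : ℂ → ℕ
  /-- Multiplicities are positive. -/
  mult_pos : ∀ l ∈ points, 0 < mult l

/-- `f` vanishes on `X`: `f^{(j)}(λ) = 0` for all `λ ∈ Λ` and all `j < m_λ`. -/
def DiskDivisor.VanishesOn (X : DiskDivisor) (f : ℂ → ℂ) : Prop :=
  ∀ l ∈ X.points, ∀ j < X.mult l, iteratedDeriv j f l = 0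

/-- `X` is a uniqueness divisor for `A^∞_α`: the only function of the space that vanishes on `X`
is the zero function (of the disk). -/
def DiskDivisor.IsUniqueness (X : DiskDivisor) (α : ℝ) : Prop :=
  ∀ f ∈ growthSpace α, X.VanishesOn f → ∀ z ∈ unitDisk, f z = 0

end BergmanUniqueness

end

open Metric Filter Topology

namespace BergmanUniqueness

/-! Put β = α + ε and let W be the weighted modulus with exponent β. Since β > α, W vanishes at the
circle and attains its maximum (`exists_forall_weightedNorm_le`). In the disk of radius √(m/(m+β))
about a zero of order m, the maximum principle rules out a nonzero maximum of W
(`exists_weightedNorm_lt`), so by the covering every maximum point lies in K. This alone is no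
contradiction. But the argument applies equally to f·z^N, whose maximum is forced towards the circle
as N grows, while K stays in |z| ≤ R < 1. -/

lemma isOpen_unitDisk : IsOpen unitDisk := isOpen_ball

lemma mem_unitDisk {z : ℂ} : z ∈ unitDisk ↔ ‖z‖ < 1 := mem_ball_zero_iff

/-- The weighted modulus `(1 - |z|²)^{β/2} |f z|`. -/
noncomputable def weightedNorm (β : ℝ) (f : ℂ → ℂ) (z : ℂ) : ℝ := (1 - ‖z‖ ^ 2) ^ (β / 2) * ‖f z‖

section Mobius

variable {l w : ℂ}

lemma re_one_sub_conj_mul_pos (hl : l ∈ unitDisk) (hw : w ∈ unitDisk) :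
    0 < (1 - (starRingEnd ℂ) l * w).re := by
  rw [mem_unitDisk] at hl hw
  have h : ‖(starRingEnd ℂ) l * w‖ < 1 := by
    rw [norm_mul, RCLike.norm_conj]
    exact mul_lt_one_of_nonneg_of_lt_one_left (norm_nonneg _) hl hw.le
  have := (Complex.re_le_norm ((starRingEnd ℂ) l * w)).trans_lt h
  simpa only [Complex.sub_re, Complex.one_re, sub_pos] using this

lemma one_sub_conj_mul_ne_zero (hl : l ∈ unitDisk) (hw : w ∈ unitDisk) :
    1 - (starRingEnd ℂ) l * w ≠ 0 := fun h ↦ by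
  simpa [h] using re_one_sub_conj_mul_pos hl hw

lemma one_sub_norm_mobius_sq (hl : l ∈ unitDisk) (hw : w ∈ unitDisk) :
    1 - ‖mobius l w‖ ^ 2 =
      (1 - ‖l‖ ^ 2) * (1 - ‖w‖ ^ 2) / ‖1 - (starRingEnd ℂ) l * w‖ ^ 2 := by
  have h := norm_ne_zero_iff.2 (one_sub_conj_mul_ne_zero hl hw)
  rw [mobius, norm_div, div_pow, eq_div_iff (pow_ne_zero 2 h), sub_mul,
    div_mul_cancel₀ _ (pow_ne_zero 2 h)]
  simp only [Complex.sq_norm, Complex.normSq_apply, Complex.sub_re, Complex.sub_im,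
    Complex.mul_re, Complex.mul_im, Complex.conj_re, Complex.conj_im, Complex.one_re,
    Complex.one_im]
  ring

lemma one_sub_norm_sq_pos (hw : w ∈ unitDisk) : 0 < 1 - ‖w‖ ^ 2 := by
  rw [mem_unitDisk] at hw
  nlinarith [norm_nonneg w]

lemma mobius_mem_unitDisk (hl : l ∈ unitDisk) (hw : w ∈ unitDisk) : mobius l w ∈ unitDisk := by
  have h : 0 < 1 - ‖mobius l w‖ ^ 2 := by
    rw [one_sub_norm_mobius_sq hl hw]
    have := norm_pos_iff.2 (one_sub_conj_mul_ne_zero hl hw)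
    have := one_sub_norm_sq_pos hl
    have := one_sub_norm_sq_pos hw
    positivity
  rw [mem_unitDisk]
  nlinarith [norm_nonneg (mobius l w)]

/-- Exposes the factor w, so that a zero of order m at l becomes w^m after the change of variable.
-/
lemma mobius_sub (hl : l ∈ unitDisk) (hw : w ∈ unitDisk) :
    mobius l w - l = w * (((starRingEnd ℂ) l * l - 1) / (1 - (starRingEnd ℂ) l * w)) := by
  have h := one_sub_conj_mul_ne_zero hl hw
  rw [mobius, div_sub' h, mul_div_assoc', div_left_inj' h]
  ring

lemma mobius_mobius (hl : l ∈ unitDisk) (hw : w ∈ unitDisk) : mobius l (mobius l w) = w := by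
  have h₁ := one_sub_conj_mul_ne_zero hl (mobius_mem_unitDisk hl hw)
  have h₂ := one_sub_conj_mul_ne_zero hl hw
  rw [mobius, div_eq_iff h₁, ← neg_inj, neg_sub, mobius_sub hl hw, mobius, mul_div_assoc',
    mul_div_assoc', div_eq_iff h₂, neg_mul, mul_assoc w, sub_mul, div_mul_cancel₀ _ h₂]
  ring

lemma differentiableOn_mobius (hl : l ∈ unitDisk) : DifferentiableOn ℂ (mobius l) unitDisk := by
  unfold mobius
  exact DifferentiableOn.fun_div (by fun_prop) (by fun_prop)
    fun w hw ↦ one_sub_conj_mul_ne_zero hl hw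

end Mobius

/-- A function holomorphic on an open set that vanishes to order `m` at a point is divisible there
by `(z - l) ^ m`. -/
lemma exists_eq_sub_pow_mul {U : Set ℂ} (hU : IsOpen U) {f : ℂ → ℂ} (hf : DifferentiableOn ℂ f U)
    {l : ℂ} (hl : l ∈ U) {m : ℕ} (h : ∀ j < m, iteratedDeriv j f l = 0) :
    ∃ g : ℂ → ℂ, DifferentiableOn ℂ g U ∧ ∀ z ∈ U, f z = (z - l) ^ m * g z := by
  have ha : AnalyticAt ℂ f l := hf.analyticAt (hU.mem_nhds hl)
  obtain ⟨g, hg, hfg⟩ := (natCast_le_analyticOrderAt ha).1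
    ((natCast_le_analyticOrderAt_iff_iteratedDeriv_eq_zero ha).2 h)
  have hne : ∀ z, z ≠ l → f z = (z - l) ^ m * (f z / (z - l) ^ m) := fun z hz ↦
    (mul_div_cancel₀ _ (pow_ne_zero m (sub_ne_zero.2 hz))).symm
  refine ⟨Function.update (fun z ↦ f z / (z - l) ^ m) l (g l), fun z hz ↦ ?_, fun z hz ↦ ?_⟩
  · rcases eq_or_ne z l with rfl | hzl
    · refine (hg.differentiableAt.congr_of_eventuallyEq ?_).differentiableWithinAt
      filter_upwards [hfg] with w hw
      rcases eq_or_ne w z with rfl | hwz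
      · simp
      · rw [Function.update_of_ne hwz, hw, smul_eq_mul,
          mul_div_cancel_left₀ _ (pow_ne_zero m (sub_ne_zero.2 hwz))]
    · have hd : DifferentiableAt ℂ (fun z ↦ f z / (z - l) ^ m) z :=
        (hf.differentiableAt (hU.mem_nhds hz)).fun_div (by fun_prop)
          (pow_ne_zero m (sub_ne_zero.2 hzl))
      refine (hd.congr_of_eventuallyEq ?_).differentiableWithinAt
      filter_upwards [isOpen_ne.mem_nhds hzl] with w hw
      rw [Function.update_of_ne hw]
  · rcases eq_or_ne z l with rfl | hzl
    · simpa using hfg.self_of_nhds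
    · rw [Function.update_of_ne hzl]
      exact hne z hzl

/-- The radial profile `t^m (1 - t²)^{β/2}` is maximal exactly at `t = √(m / (m + β))`. -/
lemma pow_mul_one_sub_sq_rpow_lt {m : ℕ} (hm : 0 < m) {β t : ℝ} (hβ : 0 < β) (ht : 0 < t)
    (htr : t < √(m / (m + β))) :
    t ^ m * (1 - t ^ 2) ^ (β / 2) <
      √(m / (m + β)) ^ m * (1 - √(m / (m + β)) ^ 2) ^ (β / 2) := by
  set r := √(m / (m + β)) with hr
  have hm' : (0 : ℝ) < m := Nat.cast_pos.2 hm
  have hr2 : r ^ 2 = m / (m + β) := Real.sq_sqrt (by positivity)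
  have hr0 : 0 < r := ht.trans htr
  have h1r : 1 - r ^ 2 = β / (m + β) := by
    rw [hr2]
    field_simp
    ring
  have h1r0 : 0 < 1 - r ^ 2 := by
    rw [h1r]
    positivity
  have htr2 : t ^ 2 < r ^ 2 := by gcongr
  have h1t0 : 0 < 1 - t ^ 2 := by linarith
  have ht2 : 0 < t ^ 2 := by positivity
  have hr20 : 0 < r ^ 2 := by positivity
  -- The bound log x ≤ x - 1 is applied to both ratios. With weights m and β the right-hand sides
  -- cancel exactly, by the choice of r.
  have e₁ : Real.log (t ^ 2 / r ^ 2) < t ^ 2 / r ^ 2 - 1 :=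
    Real.log_lt_sub_one_of_pos (by positivity) ((div_lt_one hr20).2 htr2).ne
  have e₂ : Real.log ((1 - t ^ 2) / (1 - r ^ 2)) ≤ (1 - t ^ 2) / (1 - r ^ 2) - 1 :=
    Real.log_le_sub_one_of_pos (by positivity)
  have key : m * (t ^ 2 / r ^ 2 - 1) + β * ((1 - t ^ 2) / (1 - r ^ 2) - 1) = 0 := by
    rw [h1r, hr2]
    field_simp
    ring
  rw [Real.log_div ht2.ne' hr20.ne', Real.log_pow, Real.log_pow] at e₁
  rw [Real.log_div h1t0.ne' h1r0.ne'] at e₂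
  have f₁ := mul_lt_mul_of_pos_left e₁ hm'
  have f₂ := mul_le_mul_of_nonneg_left e₂ hβ.le
  push_cast at f₁
  rw [← Real.log_lt_log_iff (by positivity) (by positivity),
    Real.log_mul (by positivity) (by positivity), Real.log_mul (by positivity) (by positivity),
    Real.log_pow, Real.log_pow, Real.log_rpow h1t0, Real.log_rpow h1r0]
  linarith

/-- Inside the pseudohyperbolic disk of radius `√(m / (m + β))` about a zero of order `m`, the
weighted modulus does not attain its maximum over the unit disk. -/
lemma exists_weightedNorm_lt {f g : ℂ → ℂ} {l z : ℂ} {m : ℕ} {β : ℝ} (hm : 0 < m) (hβ : 0 < β)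
    (hl : l ∈ unitDisk) (hg : DifferentiableOn ℂ g unitDisk)
    (hfg : ∀ z ∈ unitDisk, f z = (z - l) ^ m * g z)
    (hz : z ∈ pseudoDisk l (√(m / (m + β)))) (hfz : f z ≠ 0) :
    ∃ w ∈ unitDisk, weightedNorm β f z < weightedNorm β f w := by
  obtain ⟨hzD, hzr⟩ := hz
  set r := √(m / (m + β)) with hr
  set c : ℂ → ℂ := fun w ↦ 1 - (starRingEnd ℂ) l * w
  -- The holomorphic part of W ∘ φ_l: the rest is a constant times the radial profile. The power -β
  -- absorbs the denominator of 1 - |φ_l(w)|²; its principal branch is holomorphic because Re c > 0.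
  set H : ℂ → ℂ := fun w ↦
    (((starRingEnd ℂ) l * l - 1) / c w) ^ m * g (mobius l w) * (c w) ^ ((-β : ℝ) : ℂ)
  have hm' : (0 : ℝ) < m := Nat.cast_pos.2 hm
  have hr0 : 0 < r := Real.sqrt_pos.2 (by positivity)
  have hr1 : r < 1 := by
    rw [hr, Real.sqrt_lt' one_pos, one_pow, div_lt_one (by positivity)]
    linarith
  have hH : DifferentiableOn ℂ H unitDisk := by
    have hc : DifferentiableOn ℂ c unitDisk := by fun_prop
    refine DifferentiableOn.mul (DifferentiableOn.mul (DifferentiableOn.pow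
      (DifferentiableOn.fun_div (by fun_prop) hc fun w hw ↦ one_sub_conj_mul_ne_zero hl hw) m)
      (hg.comp (differentiableOn_mobius hl) fun w hw ↦ mobius_mem_unitDisk hl hw)) ?_
    exact hc.cpow_const fun w hw ↦ Or.inl (re_one_sub_conj_mul_pos hl hw)
  have hW : ∀ w ∈ unitDisk, weightedNorm β f (mobius l w) =
      (1 - ‖l‖ ^ 2) ^ (β / 2) * (‖w‖ ^ m * (1 - ‖w‖ ^ 2) ^ (β / 2)) * ‖H w‖ := fun w hw ↦ by
    have h₁ := one_sub_norm_sq_pos hl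
    have h₂ := one_sub_norm_sq_pos hw
    have h₃ : 0 < ‖c w‖ := norm_pos_iff.2 (one_sub_conj_mul_ne_zero hl hw)
    have h₄ : (‖c w‖ ^ 2) ^ (β / 2) = ‖c w‖ ^ β := by
      rw [← Real.rpow_natCast, ← Real.rpow_mul h₃.le]
      congr 1
      push_cast
      ring
    rw [weightedNorm, one_sub_norm_mobius_sq hl hw, hfg _ (mobius_mem_unitDisk hl hw),
      mobius_sub hl hw, Real.div_rpow (by positivity) (by positivity),
      Real.mul_rpow h₁.le h₂.le, h₄]
    simp only [H, norm_mul, norm_pow, mul_pow, Complex.norm_cpow_real, Real.rpow_neg h₃.le]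
    ring
  have hw₀D : mobius l z ∈ unitDisk := mobius_mem_unitDisk hl hzD
  set w₀ := mobius l z
  have hw₀ : mobius l w₀ = z := mobius_mobius hl hzD
  have hsub : closedBall (0 : ℂ) r ⊆ unitDisk := closedBall_subset_ball hr1
  obtain ⟨w₁, hw₁, hmax⟩ := Complex.exists_mem_frontier_isMaxOn_norm (isBounded_ball (x := (0 : ℂ)))
    (nonempty_ball.2 hr0) (hH.mono (by rwa [closure_ball _ hr0.ne'])).diffContOnCl
  rw [frontier_ball _ hr0.ne', mem_sphere_zero_iff_norm] at hw₁
  have hw₁D : w₁ ∈ unitDisk := mem_unitDisk.2 (hw₁ ▸ hr1)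
  have hle : ‖H w₀‖ ≤ ‖H w₁‖ :=
    hmax (subset_closure (mem_ball_zero_iff.2 hzr))
  have hWz : 0 < weightedNorm β f z :=
    mul_pos (Real.rpow_pos_of_pos (one_sub_norm_sq_pos hzD) _) (norm_pos_iff.2 hfz)
  refine ⟨mobius l w₁, mobius_mem_unitDisk hl hw₁D, ?_⟩
  rw [← hw₀, hW _ hw₀D] at hWz
  rw [← hw₀, hW _ hw₀D, hW _ hw₁D, hw₁]
  have hH₀ : 0 < ‖H w₀‖ := (norm_nonneg _).lt_of_ne fun h ↦ by simp [← h] at hWz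
  have hw₀0 : 0 < ‖w₀‖ := (norm_nonneg _).lt_of_ne fun h ↦ by simp [← h, hm.ne'] at hWz
  have hprofile := pow_mul_one_sub_sq_rpow_lt hm hβ hw₀0 hzr
  have hl0 := Real.rpow_pos_of_pos (one_sub_norm_sq_pos hl) (β / 2)
  have hp0 := Real.rpow_pos_of_pos (one_sub_norm_sq_pos hw₀D) (β / 2)
  refine mul_lt_mul (mul_lt_mul_of_pos_left hprofile hl0) hle hH₀ ?_
  exact (mul_pos hl0 ((mul_pos (pow_pos hw₀0 m) hp0).trans hprofile)).le

/-- For `f` in the growth space of order `α` and `β > α`, the weighted modulus with exponent `β`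
attains its maximum over the disk. -/
lemma exists_forall_weightedNorm_le {f : ℂ → ℂ} {α β : ℝ} (hα : 0 < α) (hαβ : α < β)
    (hf : f ∈ growthSpace α) {p : ℂ} (hp : p ∈ unitDisk) (hfp : f p ≠ 0) :
    ∃ z ∈ unitDisk, ∀ w ∈ unitDisk, weightedNorm β f w ≤ weightedNorm β f z := by
  obtain ⟨hd, M, hM⟩ := hf
  have hM' : ∀ w ∈ unitDisk, (1 - ‖w‖ ^ 2) ^ (α / 2) * ‖f w‖ ≤ M := fun w hw ↦
    hM (Set.mem_image_of_mem _ hw)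
  have hWp : 0 < weightedNorm β f p :=
    mul_pos (Real.rpow_pos_of_pos (one_sub_norm_sq_pos hp) _) (norm_pos_iff.2 hfp)
  -- The surplus exponent β - α makes the weighted modulus smaller than its value at p near the
  -- circle.
  have hlim : Tendsto (fun R : ℝ ↦ (1 - R ^ 2) ^ ((β - α) / 2) * M) (𝓝[<] 1) (𝓝 0) := by
    have hc : Continuous fun R : ℝ ↦ (1 - R ^ 2) ^ ((β - α) / 2) * M :=
      ((continuous_const.sub (continuous_pow 2)).rpow_const
        fun _ ↦ Or.inr (by linarith)).mul_const M
    have := hc.tendsto 1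
    simp only [one_pow, sub_self, Real.zero_rpow (by linarith : (β - α) / 2 ≠ 0), zero_mul] at this
    exact this.mono_left nhdsWithin_le_nhds
  obtain ⟨R, hR, hR1, hpR⟩ := ((hlim.eventually_lt_const hWp).and
    ((eventually_mem_nhdsWithin (a := (1 : ℝ)) (s := Set.Iio 1)).and
    (eventually_nhdsWithin_of_eventually_nhds (lt_mem_nhds (mem_unitDisk.1 hp))))).exists
  have hsub : closedBall (0 : ℂ) R ⊆ unitDisk := closedBall_subset_ball hR1
  have hcont : ContinuousOn (weightedNorm β f) (closedBall 0 R) :=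
    ContinuousOn.mul (Continuous.continuousOn ((continuous_const.sub (continuous_norm.pow 2)).rpow_const
      fun _ ↦ Or.inr (by linarith))) (hd.continuousOn.mono hsub).norm
  have hpB : p ∈ closedBall (0 : ℂ) R := mem_closedBall_zero_iff.2 hpR.le
  obtain ⟨z, hz, hmax⟩ := (isCompact_closedBall (0 : ℂ) R).exists_isMaxOn ⟨p, hpB⟩ hcont
  refine ⟨z, hsub hz, fun w hw ↦ ?_⟩
  rcases le_or_gt ‖w‖ R with hwR | hwR
  · exact hmax (mem_closedBall_zero_iff.2 hwR)
  · refine le_trans ?_ (hmax hpB)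
    refine le_trans ?_ hR.le
    have h₁ := one_sub_norm_sq_pos hw
    have hM0 : 0 ≤ M := le_trans (by positivity) (hM' w hw)
    have hR0 : 0 ≤ R := (norm_nonneg p).trans hpR.le
    calc weightedNorm β f w
        = (1 - ‖w‖ ^ 2) ^ ((β - α) / 2) * ((1 - ‖w‖ ^ 2) ^ (α / 2) * ‖f w‖) := by
          rw [weightedNorm, ← mul_assoc, ← Real.rpow_add h₁]
          congr 2
          ring
      _ ≤ (1 - ‖w‖ ^ 2) ^ ((β - α) / 2) * M := by
          gcongr
          exact hM' w hw
      _ ≤ (1 - R ^ 2) ^ ((β - α) / 2) * M := by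
          have : 0 ≤ (β - α) / 2 := by linarith
          gcongr

lemma mul_pow_mem_growthSpace {f : ℂ → ℂ} {α : ℝ} (hf : f ∈ growthSpace α) (N : ℕ) :
    (fun z ↦ f z * z ^ N) ∈ growthSpace α := by
  obtain ⟨hd, M, hM⟩ := hf
  refine ⟨hd.mul (by fun_prop), M, ?_⟩
  rintro _ ⟨z, hz, rfl⟩
  refine le_trans ?_ (hM (Set.mem_image_of_mem _ hz))
  have h₁ := one_sub_norm_sq_pos hz
  rw [mem_unitDisk] at hz
  have h₂ : ‖f z * z ^ N‖ ≤ ‖f z‖ := by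
    rw [norm_mul, norm_pow]
    exact mul_le_of_le_one_right (norm_nonneg _) (pow_le_one₀ (norm_nonneg _) hz.le)
  dsimp only
  gcongr

/-- If a holomorphic function on the disk is not identically zero, it has a nonzero value
arbitrarily close to the unit circle. -/
lemma exists_ne_zero_of_lt_norm {f : ℂ → ℂ} (hf : DifferentiableOn ℂ f unitDisk) {p : ℂ}
    (hp : p ∈ unitDisk) (hfp : f p ≠ 0) {R : ℝ} (hR0 : 0 ≤ R) (hR : R < 1) :
    ∃ q ∈ unitDisk, R < ‖q‖ ∧ f q ≠ 0 := by
  by_contra! h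
  obtain ⟨s, hRs, hs⟩ := exists_between hR
  have hnorm : ‖(s : ℂ)‖ = s := by
    rw [Complex.norm_real, Real.norm_of_nonneg (hR0.trans hRs.le)]
  have hsD : (s : ℂ) ∈ unitDisk := mem_unitDisk.2 (hnorm.trans_lt hs)
  have hev : f =ᶠ[𝓝 (s : ℂ)] 0 := by
    filter_upwards [isOpen_unitDisk.mem_nhds hsD,
      (isOpen_lt continuous_const continuous_norm).mem_nhds (hRs.trans_eq hnorm.symm)] with z hz hRz
    exact h z hz hRz
  exact hfp ((hf.analyticOnNhd isOpen_unitDisk).eqOn_zero_of_preconnected_of_eventuallyEq_zero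
    (convex_ball (0 : ℂ) 1).isPreconnected hsD hev hp)

end BergmanUniqueness

open BergmanUniqueness in
theorem theorem2p2 (α ε : ℝ) (hα : 0 < α) (hε : 0 < ε)
    (X : BergmanUniqueness.DiskDivisor)
    (K : Set ℂ) (hKcompact : IsCompact K) (hKsub : K ⊆ BergmanUniqueness.unitDisk)
    (hcover : BergmanUniqueness.unitDisk \ K ⊆
      ⋃ l ∈ X.points, BergmanUniqueness.pseudoDisk l
        (Real.sqrt ((X.mult l : ℝ) / ((X.mult l : ℝ) + α + ε)))) :
    X.IsUniqueness α := by
  intro f hf hX p hp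
  by_contra hfp
  obtain ⟨R, hR0, hR1, hKR⟩ : ∃ R : ℝ, 0 ≤ R ∧ R < 1 ∧ ∀ z ∈ K, ‖z‖ ≤ R := by
    rcases K.eq_empty_or_nonempty with rfl | hne
    · exact ⟨0, le_rfl, one_pos, by simp⟩
    · obtain ⟨k, hk, hmax⟩ := hKcompact.exists_isMaxOn hne continuous_norm.continuousOn
      exact ⟨‖k‖, norm_nonneg _, mem_unitDisk.1 (hKsub hk), fun z hz ↦ hmax hz⟩
  obtain ⟨q, hq, hRq, hfq⟩ := exists_ne_zero_of_lt_norm hf.1 hp hfp hR0 hR1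
  have hq0 : 0 < ‖q‖ := hR0.trans_lt hRq
  have hβ : 0 < α + ε := by linarith
  have hmul : ∀ (N : ℕ) z, weightedNorm (α + ε) (fun z ↦ f z * z ^ N) z =
      weightedNorm (α + ε) f z * ‖z‖ ^ N := fun N z ↦ by
    simp only [weightedNorm, norm_mul, norm_pow, mul_assoc]
  obtain ⟨z₀, -, hz₀⟩ := exists_forall_weightedNorm_le hα (lt_add_of_pos_right α hε) hf hp hfp
  set S := weightedNorm (α + ε) f z₀
  have hWq : 0 < weightedNorm (α + ε) f q :=
    mul_pos (Real.rpow_pos_of_pos (one_sub_norm_sq_pos hq) _) (norm_pos_iff.2 hfq)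
  -- Compare f·z^N at q with its maximum, attained in K where |z| ≤ R; S does not depend on N, and R
  -- < |q|.
  have hbound : ∀ N : ℕ, weightedNorm (α + ε) f q ≤ S * (R / ‖q‖) ^ N := fun N ↦ by
    have hFq : f q * q ^ N ≠ 0 := mul_ne_zero hfq (pow_ne_zero N (norm_pos_iff.1 hq0))
    obtain ⟨z, hz, hmax⟩ := exists_forall_weightedNorm_le hα (lt_add_of_pos_right α hε)
      (mul_pow_mem_growthSpace hf N) hq hFq
    have hqz := hmax q hq
    rw [hmul, hmul] at hqz
    have hpos : 0 < weightedNorm (α + ε) f z * ‖z‖ ^ N := lt_of_lt_of_le (by positivity) hqz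
    have hzK : z ∈ K := by
      by_contra hzK
      obtain ⟨l, hl, hzl⟩ := Set.mem_iUnion₂.1 (hcover ⟨hz, hzK⟩)
      rw [add_assoc] at hzl
      have hlD := X.points_subset hl
      obtain ⟨g, hg, hfg⟩ := exists_eq_sub_pow_mul isOpen_unitDisk hf.1 hlD (hX l hl)
      obtain ⟨w, hw, hlt⟩ := exists_weightedNorm_lt (f := fun z ↦ f z * z ^ N)
        (g := fun z ↦ g z * z ^ N) (X.mult_pos l hl) hβ hlD (hg.mul (by fun_prop))
        (fun z hz ↦ by rw [hfg z hz, mul_assoc]) hzl fun h ↦ by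
          rw [← hmul, weightedNorm, h, norm_zero, mul_zero] at hpos
          exact hpos.false
      exact (hmax w hw).not_gt hlt
    rw [div_pow, mul_div_assoc', le_div_iff₀ (by positivity)]
    refine hqz.trans (mul_le_mul (hz₀ z hz) (by gcongr; exact hKR z hzK) (by positivity) ?_)
    exact hWq.le.trans (hz₀ q hq)
  have hlim : Tendsto (fun N : ℕ ↦ S * (R / ‖q‖) ^ N) atTop (𝓝 0) := by
    simpa using (tendsto_pow_atTop_nhds_zero_of_lt_one (by positivity)
      ((div_lt_one hq0).2 hRq)).const_mul S
  exact hWq.not_ge (ge_of_tendsto' hlim hbound)
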